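/- All graphs are finite, simple and undirected. A \emph{ball} of a graph $G$ is a nonempty set $X$ of vertices inducing a connected subgraph $G[X]$; its radius is $\min_{c\in X}\max_{x\in X} d_{G[X]}(c,x)$. For a family $\mathcal P$ of pairwise disjoint balls of $G$, the quotient $G/\mathcal P$ is the simple graph with vertex set $\mathcal P$ in which two distinct balls are adjacent if and only if some edge of $G$ has one end in each of them. For an integer $r\ge 0$ let $$\nabla_r(G)=\max_{\mathcal P}\frac{|E(G/\mathcal P)|}{|\mathcal P|},$$ the maximum being over all families $\mathcal P$ of pairwise disjoint balls of $G$ of radius at most $r$ (the empty family contributes $0$). A class $\mathcal K$ of graphs has \emph{bounded expansion} if there is a function $f:\mathbb N\to\mathbb N$ such that $\nabla_r(G)\le f(r)$ for every $G\in\mathcal K$ and every $r\ge 0$. The \emph{odd-girth} of $G$ is the least length of an odd cycle of $G$ ($\infty$ if $G$ has no odd cycle). For an integer $p\ge1$, the \emph{exact $p$-power} $G^{\natural p}$ is the graph on $V(G)$ in which $x$ and $y$ are adjacent if and only if $G$ contains a path of length $p$ (that is, with $p$ edges and no repeated vertex) from $x$ to $y$. \textbf{Theorem.} For every class $\mathcal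 K$ of graphs with bounded expansion and every odd integer $p\ge 1$ there exists an integer $N=N(\mathcal K,p)$ such that for every $G\in\mathcal K$, $$\text{odd-girth}(G)>p\ \Longrightarrow\ \chi(G^{\natural p})\le N.$$ -/

import Mathlib

open scoped ENNReal

universe u

/-- A finite (simple, undirected) graph. -/
structure FiniteGraph where
  /-- the vertex set -/
  V : Type u
  [finite : Finite V]
  /-- the adjacency structure -/
  graph : SimpleGraph V

attribute [instance] FiniteGraph.finite

namespace SimpleGraph

variable {V : Type u}

/-- A ball of `G`: a set of vertices inducing a (nonempty) connected subgraph. -/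
def IsBall (G : SimpleGraph V) (X : Set V) : Prop :=
  (G.induce X).Connected

/-- `P` is a family of pairwise disjoint balls of `G`. -/
def IsBallFamily (G : SimpleGraph V) (P : Set (Set V)) : Prop :=
  (∀ X ∈ P, G.IsBall X) ∧ P.PairwiseDisjoint id

/-- The radius of a family of balls: the maximum of the radii of the graphs `G[X]`, `X ∈ P`. -/
noncomputable def familyRadius (G : SimpleGraph V) (P : Set (Set V)) : ℕ∞ :=
  ⨆ X ∈ P, (G.induce X).radius

/-- The quotient `G / P`: its vertices are the members of `P`, and two distinct members are
adjacent when some edge of `G` joins them. -/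
def ballQuotient (G : SimpleGraph V) (P : Set (Set V)) : SimpleGraph P where
  Adj A B := A ≠ B ∧ ∃ a ∈ A.1, ∃ b ∈ B.1, G.Adj a b
  symm := ⟨fun _ _ h => ⟨h.1.symm, let ⟨a, ha, b, hb, hab⟩ := h.2; ⟨b, hb, a, ha, hab.symm⟩⟩⟩
  loopless := ⟨fun _ h => h.1 rfl⟩

/-- The greatest reduced average density (grad) of rank `r`: the maximum of `|E(G/P)| / |P|` over
the families `P` of pairwise disjoint balls of radius at most `r`.  It is taken in `ℝ≥0∞`; for a
finite graph it is a maximum over a finite set of rationals (the empty family contributes `0`). -/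
noncomputable def grad (G : SimpleGraph V) (r : ℕ) : ℝ≥0∞ :=
  ⨆ (P : Set (Set V)) (_ : G.IsBallFamily P ∧ G.familyRadius P ≤ r),
    ((G.ballQuotient P).edgeSet.ncard : ℝ≥0∞) / (P.ncard : ℝ≥0∞)

/-- The odd-girth: the least length of an odd cycle, and `⊤` if there is no odd cycle. -/
noncomputable def oddGirth (G : SimpleGraph V) : ℕ∞ :=
  ⨅ (a : V) (w : G.Walk a a) (_ : w.IsCycle ∧ Odd w.length), (w.length : ℕ∞)

/-- The exact `p`-power of `G`: distinct `x`, `y` are adjacent when some path of `G` from `x` to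
`y` has length `p`. -/
def exactPower (G : SimpleGraph V) (p : ℕ) : SimpleGraph V where
  Adj x y := x ≠ y ∧ ∃ w : G.Walk x y, w.IsPath ∧ w.length = p
  symm := ⟨fun _ _ h => ⟨h.1.symm, let ⟨w, hw, hl⟩ := h.2;
    ⟨w.reverse, hw.reverse, by rw [Walk.length_reverse, hl]⟩⟩⟩
  loopless := ⟨fun _ h => h.1 rfl⟩

end SimpleGraph

/-- A class of finite graphs has bounded expansion if some `f : ℕ → ℕ` bounds the grad of rank `r`
of each of its members by `f r`, for every `r`. -/
def BoundedExpansion (K : Set FiniteGraph.{u}) : Prop :=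
  ∃ f : ℕ → ℕ, ∀ G ∈ K, ∀ r : ℕ, G.graph.grad r ≤ (f r : ℝ≥0∞)

/-! Bounded expansion yields an injective rank `ρ` for which boundedly many vertices are weakly
`p`-reachable from each vertex. Such a rank comes from `exists_separated_vertex`: every nonempty `S`
has a vertex that boundedly many vertices separate from the rest of `S`, for short walks. Otherwise,
contracting a maximal system of short connectors, and then balls around an independent set of `S`,
would produce a quotient that is too dense. Removing separated vertices one by one gives `ρ`
(`exists_rank`), and iterating the separators bounds weak reachability.

Greedily colour the vertices so that weakly `p`-reachable pairs differ. Give each `x` the set of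
pairs (colour of `z`, length) over the short walks from `x` to a vertex `z` of least rank on the
walk. If the ends of a path of length `p` had equal sets, the lowest vertex of the path would lie on
a closed walk of odd length `p`, against the odd-girth (`chromaticNumber_exactPower_le`). -/

namespace SimpleGraph

variable {V : Type u} {G : SimpleGraph V}

/-! ### Walks confined to a set -/

/-- Some walk from `x` to `y` has length at most `n` and stays in `A`. -/
def ReachWithin (G : SimpleGraph V) (A : Set V) (n : ℕ) (x y : V) : Prop :=
  ∃ w : G.Walk x y, w.length ≤ n ∧ ∀ z ∈ w.support, z ∈ A

namespace ReachWithin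

variable {A B : Set V} {m n : ℕ} {x y z : V}

theorem refl (hx : x ∈ A) : G.ReachWithin A n x x := ⟨.nil, by simp, by simpa using hx⟩

theorem symm (h : G.ReachWithin A n x y) : G.ReachWithin A n y x := by
  obtain ⟨w, hw, hA⟩ := h
  exact ⟨w.reverse, by simpa using hw, by simpa using hA⟩

theorem trans (h : G.ReachWithin A m x y) (h' : G.ReachWithin A n y z) :
    G.ReachWithin A (m + n) x z := by
  obtain ⟨w, hw, hA⟩ := h
  obtain ⟨w', hw', hA'⟩ := h'
  refine ⟨w.append w', by rw [Walk.length_append]; omega, fun v hv => ?_⟩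
  rcases (Walk.mem_support_append_iff _ _).1 hv with h | h
  exacts [hA v h, hA' v h]

theorem mono (h : G.ReachWithin A m x y) (hAB : A ⊆ B) (hmn : m ≤ n) : G.ReachWithin B n x y := by
  obtain ⟨w, hw, hA⟩ := h
  exact ⟨w, hw.trans hmn, fun z hz => hAB (hA z hz)⟩

theorem mem_left (h : G.ReachWithin A m x y) : x ∈ A := by
  obtain ⟨w, -, hA⟩ := h
  exact hA _ w.start_mem_support

theorem mem_right (h : G.ReachWithin A m x y) : y ∈ A := h.symm.mem_left

end ReachWithin

/-- The part of a walk before it enters `T`, and the vertex at which it does. -/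
theorem Walk.exists_first_entry {T : Set V} {a b : V} (w : G.Walk a b) (ha : a ∉ T) (hb : b ∈ T) :
    ∃ x y, ∃ q : G.Walk a x, q.length + 1 ≤ w.length ∧ (∀ z ∈ q.support, z ∈ w.support ∧ z ∉ T) ∧
      G.Adj x y ∧ y ∈ T ∧ y ∈ w.support := by
  induction w with
  | nil => exact absurd hb ha
  | @cons a c b h w ih =>
    by_cases hc : c ∈ T
    · refine ⟨a, c, .nil, by simp, by simpa using ha, h, hc, by simp⟩
    · obtain ⟨x, y, q, hq, hs, hxy, hy, hyw⟩ := ih hc hb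
      refine ⟨x, y, .cons h q, by simpa using hq, ?_, hxy, hy, by simp [hyw]⟩
      intro z hz
      rw [Walk.support_cons, List.mem_cons] at hz
      rcases hz with rfl | hz
      · exact ⟨by simp, ha⟩
      · exact ⟨by simp [(hs z hz).1], (hs z hz).2⟩

/-! ### Odd closed walks and odd cycles -/

/-- A walk whose length has not the parity of that of its bypass contains an odd cycle. -/
theorem Walk.exists_odd_cycle_of_bypass [DecidableEq V] {a b : V} (w : G.Walk a b) :
    w.length % 2 = w.bypass.length % 2 ∨
      ∃ (v : V) (c : G.Walk v v), c.IsCycle ∧ Odd c.length ∧ c.length ≤ w.length := by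
  induction w with
  | nil => left; simp [bypass]
  | @cons a c b h w ih =>
    rcases ih with ih | ⟨v, c, hc, ho, hl⟩
    swap
    · exact .inr ⟨v, c, hc, ho, by rw [length_cons]; omega⟩
    simp only [bypass]
    split_ifs with hs
    · have hle := w.length_bypass_le_length
      have hsum := congrArg Walk.length (w.bypass.take_spec hs)
      rw [length_append] at hsum
      -- The bypass returns to `a`; the new edge closes its initial part into a loop. An odd loop is
      -- the required cycle, and dropping an even one preserves parity.
      rcases Nat.even_or_odd (w.bypass.takeUntil a hs).length with he | ho
      · right
        have h0 : (w.bypass.takeUntil a hs).length ≠ 0 := fun h0 =>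
          h.ne (Walk.eq_of_length_eq_zero h0).symm
        refine ⟨a, .cons h (w.bypass.takeUntil a hs), ?_, ?_, ?_⟩
        · refine isCycle_iff_isPath_tail_and_le_length.2 ⟨?_, ?_⟩
          · simpa using w.bypass_isPath.takeUntil hs
          · rw [length_cons]
            obtain ⟨k, hk⟩ := he
            omega
        · rw [length_cons]; exact he.add_one
        · rw [length_cons, length_cons]; omega
      · left
        obtain ⟨k, hk⟩ := ho
        rw [length_cons]
        omega
    · left
      rw [length_cons, length_cons]
      omega

/-- The bypass of a closed walk is empty, hence even, so the parity alternative fails and an odd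
cycle remains. -/
theorem oddGirth_le_of_odd_closed_walk {a : V} (w : G.Walk a a) (hw : Odd w.length) :
    G.oddGirth ≤ w.length := by
  classical
  rcases w.exists_odd_cycle_of_bypass with h | ⟨v, c, hc, ho, hl⟩
  · have h0 : w.bypass.length = 0 := by
      exact Walk.length_eq_zero_iff.2 (Walk.isPath_iff_nil.1 w.bypass_isPath)
    rw [h0, Nat.odd_iff.1 hw] at h
    omega
  · exact (iInf_le_of_le v <| iInf_le_of_le c <| iInf_le _ ⟨hc, ho⟩).trans (by exact_mod_cast hl)

/-! ### Edge counts from the grad -/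

theorem radius_induce_le {B : Set V} {r : ℕ} {v : V} (hv : v ∈ B)
    (hB : ∀ x ∈ B, G.ReachWithin B r v x) : (G.induce B).radius ≤ r := by
  refine (radius_le_eccent (u := ⟨v, hv⟩)).trans ((eccent_le_iff _ _).2 fun x => ?_)
  obtain ⟨w, hw, hA⟩ := hB x x.2
  refine (edist_le (w.induce B hA)).trans ?_
  have : (w.induce B hA).length = w.length := by
    have h := congrArg List.length (w.support_induce hA)
    rw [Walk.length_support, List.length_attachWith, Walk.length_support] at h
    omega
  rw [this]
  exact_mod_cast hw

theorem isBall_of_reachWithin {B : Set V} {r : ℕ} {v : V} (hv : v ∈ B)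
    (hB : ∀ x ∈ B, G.ReachWithin B r v x) : G.IsBall B := by
  refine (connected_iff_exists_forall_reachable _).2 ⟨⟨v, hv⟩, fun x => ?_⟩
  obtain ⟨w, -, hA⟩ := hB x x.2
  exact ⟨w.induce B hA⟩

/-- A bound on the grad bounds the number of adjacent pairs among disjoint balls. -/
theorem card_le_of_grad_le [Finite V] {r f : ℕ} (hf : G.grad r ≤ f) (J : Finset V)
    (B : V → Set V) (hv : ∀ v ∈ J, v ∈ B v) (hB : ∀ v ∈ J, ∀ x ∈ B v, G.ReachWithin (B v) r v x)
    (hd : ∀ u ∈ J, ∀ v ∈ J, u ≠ v → Disjoint (B u) (B v)) (E : Finset (Sym2 V))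
    (hE : ∀ e ∈ E, ∃ a ∈ J, ∃ b ∈ J, a ≠ b ∧ e = s(a, b) ∧ ∃ x ∈ B a, ∃ y ∈ B b, G.Adj x y) :
    E.card ≤ f * J.card := by
  classical
  rcases J.eq_empty_or_nonempty with rfl | hJ
  · have : E = ∅ := Finset.eq_empty_of_forall_notMem fun e he => by simpa using hE e he
    simp [this]
  have : Nonempty V := ⟨hJ.choose⟩
  have hinj : Set.InjOn B J := fun u hu v hv' h => by
    by_contra hne
    exact Set.disjoint_left.1 (hd u hu v hv' hne) (hv u hu) (h ▸ hv u hu)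
  set P : Set (Set V) := B '' J with hP
  have hPn : P.ncard = J.card := by rw [hP, hinj.ncard_image, Set.ncard_coe_finset]
  have hfam : G.IsBallFamily P ∧ G.familyRadius P ≤ r := by
    refine ⟨⟨?_, ?_⟩, iSup₂_le ?_⟩
    · rintro _ ⟨v, hvJ, rfl⟩
      exact isBall_of_reachWithin (hv v hvJ) (hB v hvJ)
    · rintro _ ⟨u, hu, rfl⟩ _ ⟨v, hv', rfl⟩ hne
      exact hd u hu v hv' fun h => hne (by rw [h])
    · rintro _ ⟨v, hvJ, rfl⟩
      exact radius_induce_le (hv v hvJ) (hB v hvJ)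
  have hq : ((G.ballQuotient P).edgeSet.ncard : ℝ≥0∞) / (P.ncard : ℝ≥0∞) ≤ f :=
    (le_iSup₂_of_le P hfam le_rfl).trans hf
  have hle : (G.ballQuotient P).edgeSet.ncard ≤ f * J.card := by
    rw [hPn, ENNReal.div_le_iff (by simpa using hJ.ne_empty) (by simp)] at hq
    exact_mod_cast hq
  refine le_trans ?_ hle
  let c : P → V := fun X => Function.invFunOn B J X.1
  have hc : ∀ v (h : v ∈ J), c ⟨B v, v, h, rfl⟩ = v := fun v h =>
    hinj.leftInvOn_invFunOn h
  have hsub : (E : Set (Sym2 V)) ⊆ Sym2.map c '' (G.ballQuotient P).edgeSet := by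
    intro e he
    obtain ⟨a, ha, b, hb, hab, rfl, x, hx, y, hy, hxy⟩ := hE e he
    refine ⟨s(⟨B a, a, ha, rfl⟩, ⟨B b, b, hb, rfl⟩), ?_, ?_⟩
    · refine ⟨fun h => hab ?_, x, hx, y, hy, hxy⟩
      exact hinj ha hb (Subtype.ext_iff.1 h)
    · rw [Sym2.map_mk, hc a ha, hc b hb]
  rw [← Set.ncard_coe_finset]
  exact (Set.ncard_le_ncard hsub (Set.toFinite _)).trans (Set.ncard_image_le (Set.toFinite _))

/-- A graph with few edges has a large independent set of vertices of small degree. -/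
theorem exists_independent_of_card_edges_le [Fintype V] (H : SimpleGraph V) [DecidableRel H.Adj]
    (S : Finset V) (c : ℕ) (hc : H.edgeFinset.card ≤ c * S.card) :
    ∃ I ⊆ S, (∀ v ∈ I, H.degree v ≤ 4 * c) ∧ (∀ u ∈ I, ∀ v ∈ I, ¬ H.Adj u v) ∧
      S.card ≤ 2 * (4 * c + 1) * I.card := by
  classical
  let L := S.filter fun v => H.degree v ≤ 4 * c
  -- Degree sum: fewer than half of the vertices of a nonempty `S` have degree above `4 * c`.
  have hhigh : (4 * c + 1) * (S.filter fun v => ¬ H.degree v ≤ 4 * c).card ≤ 2 * (c * S.card) := by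
    calc _ = ∑ v ∈ S.filter fun v => ¬ H.degree v ≤ 4 * c, (4 * c + 1) := by
          rw [Finset.sum_const, smul_eq_mul, mul_comm]
      _ ≤ ∑ v ∈ S.filter fun v => ¬ H.degree v ≤ 4 * c, H.degree v :=
          Finset.sum_le_sum fun v hv => by
            have := (Finset.mem_filter.1 hv).2
            omega
      _ ≤ ∑ v, H.degree v := Finset.sum_le_univ_sum_of_nonneg fun _ => Nat.zero_le _
      _ = 2 * H.edgeFinset.card := H.sum_degrees_eq_twice_card_edges
      _ ≤ _ := Nat.mul_le_mul_left _ hc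
  have hsplit := Finset.card_filter_add_card_filter_not (s := S) fun v => H.degree v ≤ 4 * c
  have hL : S.card ≤ 2 * L.card := by
    change L.card + _ = _ at hsplit
    by_contra hlt
    have : S.card + 1 ≤ 2 * (S.filter fun v => ¬ H.degree v ≤ 4 * c).card := by omega
    nlinarith
  obtain ⟨I, hI, hmax⟩ := Finset.exists_max_image
    (L.powerset.filter fun I => ∀ u ∈ I, ∀ v ∈ I, ¬ H.Adj u v) Finset.card ⟨∅, by simp⟩
  rw [Finset.mem_filter, Finset.mem_powerset] at hI
  obtain ⟨hIL, hind⟩ := hI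
  have hdeg : ∀ v ∈ I, H.degree v ≤ 4 * c := fun v hv => (Finset.mem_filter.1 (hIL hv)).2
  refine ⟨I, hIL.trans (Finset.filter_subset _ _), hdeg, hind, ?_⟩
  -- By maximality of `I`, its closed neighbourhoods, each of size at most `4 * c + 1`, cover `L`.
  have hcov : L ⊆ I.biUnion fun v => insert v (H.neighborFinset v) := by
    intro x hx
    by_contra hn
    simp only [Finset.mem_biUnion, Finset.mem_insert, mem_neighborFinset, not_exists, not_and,
      not_or] at hn
    have hxI : x ∉ I := fun h => (hn x h).1 rfl
    have hmem : insert x I ∈ L.powerset.filter fun I => ∀ u ∈ I, ∀ v ∈ I, ¬ H.Adj u v := by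
      rw [Finset.mem_filter, Finset.mem_powerset]
      refine ⟨Finset.insert_subset hx hIL, fun u hu v hv huv => ?_⟩
      rcases Finset.mem_insert.1 hu with rfl | hu' <;>
        rcases Finset.mem_insert.1 hv with rfl | hv'
      · exact huv.ne rfl
      · exact (hn v hv').2 huv.symm
      · exact (hn u hu').2 huv
      · exact hind u hu' v hv' huv
    have := hmax _ hmem
    rw [Finset.card_insert_of_notMem hxI] at this
    omega
  have hLI : L.card ≤ I.card * (4 * c + 1) :=
    (Finset.card_le_card hcov).trans <| Finset.card_biUnion_le_card_mul _ _ _ fun v hv =>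
      (Finset.card_insert_le _ _).trans (by
        rw [card_neighborFinset_eq_degree]
        exact Nat.add_le_add_right (hdeg v hv) 1)
  nlinarith

/-! ### Connectors -/

/-- `(a, b, Z)` is a connector of `S` if a walk of length at most `n` leaves `a ∈ S`, stays in
`Z`, which avoids `S`, and ends at a neighbour of `b ∈ S`. -/
def IsConnector (G : SimpleGraph V) (S : Finset V) (n : ℕ) (t : V × V × Finset V) : Prop :=
  t.1 ∈ S ∧ t.2.1 ∈ S ∧ t.1 ≠ t.2.1 ∧ (∀ z ∈ t.2.2, z ∉ S) ∧
    ∃ x, ∃ w : G.Walk t.1 x, w.length ≤ n ∧ G.Adj x t.2.1 ∧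
      ∀ z, z ∈ t.2.2 ↔ z ∈ w.support ∧ z ≠ t.1

/-- A family of connectors that are disjoint and join distinct pairs. -/
def IsConnectorFamily (G : SimpleGraph V) (S : Finset V) (n : ℕ) (T : Finset (V × V × Finset V)) :
    Prop :=
  (∀ t ∈ T, G.IsConnector S n t) ∧
    ∀ t ∈ T, ∀ t' ∈ T, t ≠ t' → Disjoint t.2.2 t'.2.2 ∧ s(t.1, t.2.1) ≠ s(t'.1, t'.2.1)

theorem IsConnector.card_le {S : Finset V} {n : ℕ} {t : V × V × Finset V}
    (h : G.IsConnector S n t) : t.2.2.card ≤ n + 1 := by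
  classical
  obtain ⟨-, -, -, -, x, w, hw, -, hZ⟩ := h
  have : t.2.2 ⊆ w.support.toFinset := fun z hz => List.mem_toFinset.2 ((hZ z).1 hz).1
  refine (Finset.card_le_card this).trans ((List.toFinset_card_le _).trans ?_)
  rw [Walk.length_support]
  omega

theorem exists_maximal_connectorFamily [Finite V] (G : SimpleGraph V) (S : Finset V) (n : ℕ) :
    ∃ T, G.IsConnectorFamily S n T ∧ ∀ t, G.IsConnector S n t →
      (∀ t' ∈ T, Disjoint t.2.2 t'.2.2) → ∃ t' ∈ T, s(t.1, t.2.1) = s(t'.1, t'.2.1) := by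
  classical
  have := Fintype.ofFinite V
  obtain ⟨T, hT, hmax⟩ := Finset.exists_max_image
    (Finset.univ.filter fun T => G.IsConnectorFamily S n T) Finset.card
    ⟨∅, by simp [IsConnectorFamily]⟩
  rw [Finset.mem_filter] at hT
  refine ⟨T, hT.2, fun t ht hd => ?_⟩
  by_contra! hne
  have htT : t ∉ T := fun h => hne t h rfl
  have hins : G.IsConnectorFamily S n (insert t T) := by
    refine ⟨fun s hs => ?_, fun s hs s' hs' hss => ?_⟩
    · rcases Finset.mem_insert.1 hs with rfl | hs
      exacts [ht, hT.2.1 s hs]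
    · rcases Finset.mem_insert.1 hs with rfl | h <;>
        rcases Finset.mem_insert.1 hs' with rfl | h'
      · exact absurd rfl hss
      · exact ⟨hd _ h', hne _ h'⟩
      · exact ⟨(hd _ h).symm, (hne _ h).symm⟩
      · exact hT.2.2 s h s' h' hss
  have := hmax (insert t T) (by simpa using hins)
  rw [Finset.card_insert_of_notMem htT] at this
  omega

/-- Merge each `a ∈ S` with the sets `Z` of the connectors leaving it. These are disjoint balls of
radius at most `n`, and the last step of each connector gives a quotient edge; distinct pairs give
distinct edges. -/
theorem IsConnectorFamily.card_le [Finite V] {S : Finset V} {n c : ℕ}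
    {T : Finset (V × V × Finset V)} (hT : G.IsConnectorFamily S n T) (hc : G.grad n ≤ c) :
    T.card ≤ c * S.card := by
  classical
  let B : V → Set V := fun a => {z | z = a ∨ ∃ t ∈ T, t.1 = a ∧ z ∈ t.2.2}
  have hinj : Set.InjOn (fun t : V × V × Finset V => s(t.1, t.2.1)) T := fun t ht t' ht' h => by
    by_contra hne
    exact (hT.2 t ht t' ht' hne).2 h
  rw [← Finset.card_image_of_injOn hinj]
  refine card_le_of_grad_le hc S B (fun v _ => .inl rfl) ?_ ?_ _ ?_
  · rintro a - z (rfl | ⟨t, ht, rfl, hz⟩)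
    · exact .refl (.inl rfl)
    · obtain ⟨-, -, -, -, x, w, hw, -, hZ⟩ := hT.1 t ht
      have hzw := ((hZ z).1 hz).1
      refine ⟨w.takeUntil z hzw, (w.length_takeUntil_le_length hzw).trans hw, fun y hy => ?_⟩
      by_cases hyt : y = t.1
      · exact .inl hyt
      · exact .inr ⟨t, ht, rfl, (hZ y).2 ⟨w.support_takeUntil_subset_support hzw hy, hyt⟩⟩
  · intro a ha b hb hab
    refine Set.disjoint_left.2 ?_
    rintro z (rfl | ⟨t, ht, rfl, hz⟩) (h | ⟨t', ht', rfl, hz'⟩)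
    · exact hab h
    · exact (hT.1 t' ht').2.2.2.1 z hz' ha
    · exact (hT.1 t ht).2.2.2.1 z hz (h ▸ hb)
    · exact Finset.disjoint_left.1 (hT.2 t ht t' ht' fun h => hab (by rw [h])).1 hz hz'
  · intro e he
    obtain ⟨t, ht, rfl⟩ := Finset.mem_image.1 he
    obtain ⟨ha, hb, hab, -, x, w, -, hx, hZ⟩ := hT.1 t ht
    refine ⟨t.1, ha, t.2.1, hb, hab, rfl, x, ?_, t.2.1, .inl rfl, hx⟩
    by_cases hxt : x = t.1
    · exact .inl hxt
    · exact .inr ⟨t, ht, rfl, (hZ x).2 ⟨w.end_mem_support, hxt⟩⟩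

/-! ### Separated vertices -/

/-- In a graph of small grad, every nonempty `S` has a vertex that few vertices separate, for walks
of bounded length, from the rest of `S`. -/
theorem exists_separated_vertex [Finite V] {R c f : ℕ} (hc : G.grad (2 * R) ≤ c)
    (hf : G.grad R ≤ f) (S : Finset V) (hS : S.Nonempty) :
    ∃ v ∈ S, ∃ X : Finset V, v ∉ X ∧
      X.card ≤ 4 * c + f * (1 + 2 * (2 * R + 1) * c * (4 * c + 1)) ∧
      ∀ u ∈ S, u ≠ v → ∀ w : G.Walk v u, w.length ≤ R → ∃ x ∈ w.support, x ∈ X := by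
  classical
  have := Fintype.ofFinite V
  -- `4 * c` pays for the `H`-neighbours of a vertex of `I`; the other term is `f` times the bound
  -- on `(|I| + |U|) / |I|`.
  set M := 4 * c + f * (1 + 2 * (2 * R + 1) * c * (4 * c + 1)) with hM
  by_contra! hstuck
  obtain ⟨T, hT, hmax⟩ := G.exists_maximal_connectorFamily S (2 * R)
  have hTc := hT.card_le hc
  let E : Finset (Sym2 V) := T.image fun t => s(t.1, t.2.1)
  obtain ⟨H, hH⟩ : ∃ H, H = fromEdgeSet (E : Set (Sym2 V)) := ⟨_, rfl⟩
  have hHE : H.edgeFinset.card ≤ c * S.card := by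
    refine (Finset.card_le_card (t := E) fun e he => ?_).trans (Finset.card_image_le.trans hTc)
    rw [mem_edgeFinset, hH, edgeSet_fromEdgeSet] at he
    exact he.1
  obtain ⟨I, hIS, hdeg, hind, hSI⟩ := H.exists_independent_of_card_edges_le S c hHE
  let U : Finset V := T.biUnion fun t => t.2.2
  have hU : U.card ≤ T.card * (2 * R + 1) :=
    Finset.card_biUnion_le_card_mul _ _ _ fun t ht => (hT.1 t ht).card_le
  have hUS : ∀ z ∈ U, z ∉ S := fun z hz => by
    obtain ⟨t, ht, hz⟩ := Finset.mem_biUnion.1 hz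
    exact (hT.1 t ht).2.2.2.1 z hz
  -- A short walk between two vertices of `S` outside `S ∪ U` certifies an edge of `H`.
  have hedge : ∀ v ∈ S, ∀ y ∈ S, v ≠ y → ∀ x, ∀ q : G.Walk v x, q.length ≤ 2 * R →
      (∀ z ∈ q.support, z ≠ v → z ∉ S ∧ z ∉ U) → G.Adj x y → H.Adj v y := by
    intro v hv y hy hvy x q hq hqs hxy
    have hcon : G.IsConnector S (2 * R) (v, y, q.support.toFinset.erase v) := by
      refine ⟨hv, hy, hvy, fun z hz => ?_, x, q, hq, hxy, fun z => by simp [and_comm]⟩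
      rw [Finset.mem_erase, List.mem_toFinset] at hz
      exact (hqs z hz.2 hz.1).1
    have hdis : ∀ t ∈ T, Disjoint (q.support.toFinset.erase v) t.2.2 := fun t ht => by
      refine Finset.disjoint_left.2 fun z hz hzt => ?_
      rw [Finset.mem_erase, List.mem_toFinset] at hz
      exact (hqs z hz.2 hz.1).2 (Finset.mem_biUnion.2 ⟨t, ht, hzt⟩)
    obtain ⟨t, ht, hte⟩ := hmax _ hcon hdis
    rw [hH]
    exact (fromEdgeSet_adj _).2 ⟨Finset.mem_image.2 ⟨t, ht, hte.symm⟩, hvy⟩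
  let D : V → Set V := fun v => {z | z = v ∨ z ∉ S ∧ z ∉ U}
  let B : V → Set V := fun v => {x | G.ReachWithin (D v) R v x}
  have hBD : ∀ v, ∀ x ∈ B v, x ∈ D v := fun v x hx => hx.mem_right
  -- Two balls that meet give a walk of length at most `2 * R` avoiding `S` and `U` except at its
  -- centres, hence an edge of `H` inside `I`.
  have hBdisj : ∀ u ∈ I, ∀ v ∈ I, u ≠ v → Disjoint (B u) (B v) := by
    intro u hu v hv huv
    refine Set.disjoint_left.2 fun m hmu hmv => hind u hu v hv ?_
    have hmono : ∀ a ∈ ({u, v} : Set V), D a ⊆ {z | z = u ∨ z = v ∨ z ∉ S ∧ z ∉ U} := by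
      rintro a (rfl | rfl) z (rfl | hz)
      · exact .inl rfl
      · exact .inr (.inr hz)
      · exact .inr (.inl rfl)
      · exact .inr (.inr hz)
    obtain ⟨w, hw, hws⟩ := (ReachWithin.mono hmu (hmono u (by simp)) le_rfl).trans
      (ReachWithin.mono hmv (hmono v (by simp)) le_rfl).symm
    obtain ⟨x, y, q, hq, hqs, hxy, hy, -⟩ :=
      w.exists_first_entry (T := {v}) (by simpa using huv) rfl
    obtain rfl : y = v := hy
    refine hedge u (hIS hu) y (hIS hv) huv x q (by omega) (fun z hz hzu => ?_) hxy
    rcases hws z (hqs z hz).1 with h | h | h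
    · exact absurd h hzu
    · exact absurd h (hqs z hz).2
    · exact h
  let N : V → Finset V := fun v => U.filter fun u => ∃ x ∈ B v, G.Adj x u
  -- Otherwise `N v` and the `H`-neighbours of `v` form a separator of size at most `M`: a short
  -- walk to the rest of `S` first meets `U` in `N v`, or `S \ {v}` in an `H`-neighbour.
  have hN : ∀ v ∈ I, M + 1 ≤ (N v).card + 4 * c := by
    intro v hv
    have hvS := hIS hv
    by_contra hlt
    have hcard : (N v ∪ H.neighborFinset v).card ≤ M := by
      refine (Finset.card_union_le _ _).trans ?_
      rw [card_neighborFinset_eq_degree]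
      have := hdeg v hv
      omega
    have hvX : v ∉ N v ∪ H.neighborFinset v := by
      rw [Finset.mem_union, not_or, mem_neighborFinset]
      exact ⟨fun h => hUS v (Finset.mem_filter.1 h).1 hvS, fun h => h.ne rfl⟩
    obtain ⟨u, hu, huv, w, hw, hwX⟩ := hstuck v hvS _ hvX hcard
    obtain ⟨x, y, q, hq, hqs, hxy, hy, hyw⟩ := w.exists_first_entry
      (T := {z | z ≠ v ∧ z ∈ S ∨ z ∈ U})
      (by rintro (h | h); exacts [h.1 rfl, hUS v h hvS]) (.inl ⟨huv, hu⟩)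
    have hqD : ∀ z ∈ q.support, z ∈ D v := fun z hz => by
      have h := (hqs z hz).2
      by_cases hzv : z = v
      · exact .inl hzv
      · exact .inr ⟨fun hzS => h (.inl ⟨hzv, hzS⟩), fun hzU => h (.inr hzU)⟩
    have hyX := hwX y hyw
    rw [Finset.mem_union, not_or, mem_neighborFinset] at hyX
    rcases hy with ⟨hyv, hyS⟩ | hyU
    · exact hyX.2 (hedge v hvS y hyS (Ne.symm hyv) x q (by omega)
        (fun z hz hzv => (hqD z hz).resolve_left hzv) hxy)
    · exact hyX.1 (Finset.mem_filter.2 ⟨hyU, x, ⟨q, by omega, hqD⟩, hxy⟩)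
  have hIU : ∀ v ∈ I, v ∉ U := fun v hv hvU => hUS v hvU (hIS hv)
  -- Count the edges between the balls around `I` and the vertices of `U`.
  let F : Finset (Sym2 V) := (I.sigma N).image fun a => s(a.1, a.2)
  have hFinj : Set.InjOn (fun a : (_ : V) × V => s(a.1, a.2)) (I.sigma N : Finset _) := by
    rintro ⟨a, b⟩ hab ⟨a', b'⟩ hab' h
    rw [Finset.mem_coe, Finset.mem_sigma] at hab hab'
    rcases Sym2.eq_iff.1 h with ⟨h1, h2⟩ | ⟨h1, h2⟩
    · simp only at h1 h2
      rw [h1, h2]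
    · simp only at h1 h2 hab hab'
      exact absurd (h1 ▸ (Finset.mem_filter.1 hab'.2).1) (hIU a hab.1)
  have hFcard : F.card ≤ f * (I ∪ U).card := by
    -- Vertices of `U` serve as singleton balls, which the balls around `I` avoid by definition of
    -- `D`.
    refine card_le_of_grad_le hf (I ∪ U) (fun v => if v ∈ I then B v else {v}) ?_ ?_ ?_ F ?_
    · intro v _
      split_ifs
      · exact .refl (.inl rfl)
      · rfl
    · intro v _ x hx
      split_ifs at hx ⊢ with hvI
      · obtain ⟨w, hw, hwD⟩ := hx
        refine ⟨w, hw, fun z hz => ⟨w.takeUntil z hz,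
          (w.length_takeUntil_le_length hz).trans hw, fun y hy => hwD y ?_⟩⟩
        exact w.support_takeUntil_subset_support hz hy
      · obtain rfl : x = v := hx
        exact .refl rfl
    · have hmix : ∀ u ∈ I, ∀ v ∈ I ∪ U, v ∉ I → v ∉ B u := fun u hu v hv hvI hvB => by
        have hvU := (Finset.mem_union.1 hv).resolve_left hvI
        rcases hBD u v hvB with rfl | h
        · exact hvI hu
        · exact h.2 hvU
      intro u hu v hv huv
      split_ifs with huI hvI hvI
      · exact hBdisj u huI v hvI huv
      · exact Set.disjoint_singleton_right.2 (hmix u huI v hv hvI)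
      · exact Set.disjoint_singleton_left.2 (hmix v hvI u hu huI)
      · simpa using huv
    · intro e he
      obtain ⟨⟨v, u⟩, hvu, rfl⟩ := Finset.mem_image.1 he
      obtain ⟨hv, hu⟩ := Finset.mem_sigma.1 hvu
      obtain ⟨huU, x, hx, hxu⟩ := Finset.mem_filter.1 hu
      have huI : u ∉ I := fun h => hIU u h huU
      refine ⟨v, Finset.mem_union_left _ hv, u, Finset.mem_union_right _ huU, ?_, rfl, x, ?_, u,
        ?_, hxu⟩
      · rintro rfl
        exact huI hv
      · simpa [show v ∈ I from hv] using hx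
      · simp [huI]
  have hFM : I.card * (M + 1) ≤ F.card + I.card * (4 * c) := by
    rw [Finset.card_image_of_injOn hFinj, Finset.card_sigma, ← smul_eq_mul, ← smul_eq_mul,
      ← Finset.sum_const, ← Finset.sum_const, ← Finset.sum_add_distrib]
    exact Finset.sum_le_sum hN
  have hIpos : 0 < I.card := by
    by_contra h0
    have := hS.card_pos
    rw [show I.card = 0 by omega] at hSI
    omega
  have hUI : U.card ≤ 2 * (2 * R + 1) * c * (4 * c + 1) * I.card := by
    calc U.card ≤ T.card * (2 * R + 1) := hU
      _ ≤ (c * (2 * (4 * c + 1) * I.card)) * (2 * R + 1) :=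
        Nat.mul_le_mul_right _ (hTc.trans (Nat.mul_le_mul_left _ hSI))
      _ = _ := by ring
  have hfinal : F.card ≤ f * (I.card + 2 * (2 * R + 1) * c * (4 * c + 1) * I.card) :=
    hFcard.trans (Nat.mul_le_mul_left _ ((Finset.card_union_le _ _).trans
      (Nat.add_le_add_left hUI _)))
  have : I.card * (M + 1) ≤ I.card * M := by
    calc _ ≤ _ := hFM.trans (Nat.add_le_add_right hfinal _)
      _ = I.card * M := by rw [hM]; ring
  rw [mul_add] at this
  omega

/-! ### From separators to weak reachability -/

/-- Choosing separated vertices one after the other, the last one first, ranks the vertices. -/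
theorem exists_rank [Finite V] {R M : ℕ}
    (h : ∀ S : Finset V, S.Nonempty → ∃ v ∈ S, ∃ X : Finset V, v ∉ X ∧ X.card ≤ M ∧
      ∀ u ∈ S, u ≠ v → ∀ w : G.Walk v u, w.length ≤ R → ∃ x ∈ w.support, x ∈ X) :
    ∃ ρ : V → ℕ, Function.Injective ρ ∧ ∀ v, ∃ X : Finset V, v ∉ X ∧ X.card ≤ M ∧
      ∀ u, ρ u < ρ v → ∀ w : G.Walk v u, w.length ≤ R → ∃ x ∈ w.support, x ∈ X := by
  classical
  have := Fintype.ofFinite V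
  suffices hS : ∀ n, ∀ S : Finset V, S.card = n → ∃ ρ : V → ℕ, (∀ v ∈ S, ρ v < n) ∧
      Set.InjOn ρ S ∧ ∀ v ∈ S, ∃ X : Finset V, v ∉ X ∧ X.card ≤ M ∧
        ∀ u ∈ S, ρ u < ρ v → ∀ w : G.Walk v u, w.length ≤ R → ∃ x ∈ w.support, x ∈ X by
    obtain ⟨ρ, -, hinj, hX⟩ := hS _ Finset.univ rfl
    refine ⟨ρ, fun a b hab => hinj (by simp) (by simp) hab, fun v => ?_⟩
    obtain ⟨X, hv, hM, hw⟩ := hX v (Finset.mem_univ v)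
    exact ⟨X, hv, hM, fun u => hw u (Finset.mem_univ u)⟩
  intro n
  induction n with
  | zero =>
    intro S hS
    rw [Finset.card_eq_zero] at hS
    subst hS
    exact ⟨fun _ => 0, by simp, by simp, by simp⟩
  | succ n ih =>
    intro S hS
    obtain ⟨v, hvS, X, hvX, hXM, hX⟩ := h S (Finset.card_pos.1 (by omega))
    obtain ⟨ρ, hlt, hinj, hρ⟩ := ih (S.erase v) (by rw [Finset.card_erase_of_mem hvS]; omega)
    have hne : ∀ u, u ≠ v → Function.update ρ v n u = ρ u := fun u hu =>
      Function.update_of_ne hu _ _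
    have hv : Function.update ρ v n v = n := Function.update_self _ _ _
    have hlt' : ∀ u ∈ S, u ≠ v → Function.update ρ v n u < n := fun u hu huv => by
      rw [hne u huv]
      exact hlt u (Finset.mem_erase.2 ⟨huv, hu⟩)
    refine ⟨Function.update ρ v n, fun u hu => ?_, fun a ha b hb hab => ?_, fun u hu => ?_⟩
    · by_cases huv : u = v
      · rw [huv, hv]; omega
      · exact (hlt' u hu huv).trans (Nat.lt_succ_self n)
    · by_cases hav : a = v <;> by_cases hbv : b = v
      · rw [hav, hbv]
      · have := hlt' b hb hbv
        rw [← hab, hav, hv] at this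
        omega
      · have := hlt' a ha hav
        rw [hab, hbv, hv] at this
        omega
      · rw [hne a hav, hne b hbv] at hab
        exact hinj (Finset.mem_coe.2 (Finset.mem_erase.2 ⟨hav, ha⟩))
          (Finset.mem_coe.2 (Finset.mem_erase.2 ⟨hbv, hb⟩)) hab
    · by_cases huv : u = v
      · subst huv
        refine ⟨X, hvX, hXM, fun x hx hxu => hX x hx ?_⟩
        rintro rfl
        exact lt_irrefl _ hxu
      · obtain ⟨Y, huY, hYM, hY⟩ := hρ u (Finset.mem_erase.2 ⟨huv, hu⟩)
        refine ⟨Y, huY, hYM, fun x hx hxu => ?_⟩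
        have hxv : x ≠ v := by
          rintro rfl
          have := hlt' u hu huv
          omega
        rw [hne x hxv, hne u huv] at hxu
        exact hY x (Finset.mem_erase.2 ⟨hxv, hx⟩) hxu

/-- If few vertices separate each vertex from the lower ones, then few vertices are weakly
reachable from each vertex. -/
theorem exists_finset_weaklyReachable {R M : ℕ} {ρ : V → ℕ} (hinj : Function.Injective ρ)
    (hρ : ∀ v, ∃ X : Finset V, v ∉ X ∧ X.card ≤ M ∧
      ∀ u, ρ u < ρ v → ∀ w : G.Walk v u, w.length ≤ R → ∃ x ∈ w.support, x ∈ X)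
    (n : ℕ) (hn : n ≤ R) (v : V) :
    ∃ F : Finset V, F.card ≤ (M + 1) ^ n ∧
      ∀ u, G.ReachWithin {x | ρ u ≤ ρ x} n v u → u ∈ F := by
  classical
  induction n generalizing v with
  | zero =>
    refine ⟨{v}, by simp, fun u ⟨w, hw, _⟩ => ?_⟩
    rw [Walk.eq_of_length_eq_zero (Nat.le_zero.1 hw), Finset.mem_singleton]
  | succ n ih =>
    choose F hF hmem using ih (by omega)
    obtain ⟨X, hvX, hXM, hX⟩ := hρ v
    refine ⟨(insert v X).biUnion F, ?_, fun u hu => ?_⟩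
    · refine (Finset.card_biUnion_le_card_mul _ _ _ fun x _ => hF x).trans ?_
      rw [pow_succ, mul_comm]
      exact Nat.mul_le_mul_left _ ((Finset.card_insert_le _ _).trans (by omega))
    · rw [Finset.mem_biUnion]
      by_cases huv : u = v
      · subst huv
        exact ⟨u, Finset.mem_insert_self _ _, hmem u u (.refl (Set.mem_ofPred.2 le_rfl))⟩
      · obtain ⟨w, hw, hws⟩ := hu
        have hlt : ρ u < ρ v := lt_of_le_of_ne (hws v w.start_mem_support) fun h => huv (hinj h)
        obtain ⟨x, hxw, hxX⟩ := hX u hlt w (hw.trans hn)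
        have hxv : x ≠ v := by
          rintro rfl
          exact hvX hxX
        -- As `x ≠ v`, the rest of the walk is strictly shorter, so the set for `x` at `n` catches
        -- `u`.
        have := Walk.length_dropUntil_lt_length hxw hxv
        exact ⟨x, Finset.mem_insert_of_mem hxX, hmem x u ⟨w.dropUntil x hxw, by omega,
          fun z hz => hws z (w.support_dropUntil_subset_support hxw hz)⟩⟩

/-! ### Colouring the exact power -/

/-- Greedy colouring along an injective rank. -/
theorem exists_greedy_colouring [Finite V] {C : ℕ} {ρ : V → ℕ} (hinj : Function.Injective ρ)
    (F : V → Finset V) (hF : ∀ v, (F v).card ≤ C) :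
    ∃ a : V → Fin (C + 1), ∀ v, ∀ u ∈ F v, ρ u < ρ v → a u ≠ a v := by
  classical
  have := Fintype.ofFinite V
  suffices h : ∀ n, ∃ a : V → Fin (C + 1), ∀ v, ρ v < n → ∀ u ∈ F v, ρ u < ρ v → a u ≠ a v by
    obtain ⟨a, ha⟩ := h (Finset.univ.sup ρ + 1)
    exact ⟨a, fun v => ha v (Nat.lt_succ_of_le (Finset.le_sup (Finset.mem_univ v)))⟩
  intro n
  induction n with
  | zero => exact ⟨fun _ => 0, fun v hv => absurd hv (Nat.not_lt_zero _)⟩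
  | succ n ih =>
    obtain ⟨a, ha⟩ := ih
    by_cases hn : ∃ v, ρ v = n
    · obtain ⟨v, hv⟩ := hn
      obtain ⟨i, hi⟩ : ∃ i, i ∉ (F v).image a := by
        by_contra! hall
        have h1 : (Finset.univ : Finset (Fin (C + 1))).card ≤ ((F v).image a).card :=
          Finset.card_le_card fun i _ => hall i
        have h2 := Finset.card_image_le (s := F v) (f := a)
        have h3 := hF v
        rw [Finset.card_univ, Fintype.card_fin] at h1
        omega
      refine ⟨Function.update a v i, fun x hx u hu hux => ?_⟩
      have huv : u ≠ v := by
        rintro rfl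
        omega
      rw [Function.update_of_ne huv]
      by_cases hxv : x = v
      · subst hxv
        rw [Function.update_self]
        rintro rfl
        exact hi (Finset.mem_image_of_mem a hu)
      · rw [Function.update_of_ne hxv]
        have : ρ x ≠ n := fun h => hxv (hinj (h.trans hv.symm))
        exact ha x (by omega) u hu hux
    · refine ⟨a, fun x hx => ha x ?_⟩
      have : ρ x ≠ n := fun h => hn ⟨x, h⟩
      omega

/-- A rank for which at most `C` vertices are weakly `p`-reachable from each vertex bounds the
chromatic number of the exact `p`-power, if there is no odd closed walk of length `p`. -/
theorem chromaticNumber_exactPower_le [Finite V] {p C : ℕ} (hp : Odd p) (hG : p < G.oddGirth)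
    {ρ : V → ℕ} (hinj : Function.Injective ρ)
    (hρ : ∀ v, ∃ F : Finset V, F.card ≤ C ∧ ∀ u, G.ReachWithin {x | ρ u ≤ ρ x} p v u → u ∈ F) :
    (G.exactPower p).chromaticNumber ≤ (2 ^ ((C + 1) * (p + 1)) : ℕ) := by
  classical
  choose F hFC hF using hρ
  obtain ⟨a, ha⟩ := exists_greedy_colouring hinj F hFC
  let κ : V → Set (Fin (C + 1) × Fin (p + 1)) := fun x =>
    {c | ∃ z, a z = c.1 ∧ ∃ w : G.Walk x z, w.length = c.2 ∧ ∀ y ∈ w.support, ρ z ≤ ρ y}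
  have hκ : ∀ {x y}, (G.exactPower p).Adj x y → κ x ≠ κ y := by
    rintro x y ⟨-, w, -, hw⟩ heq
    obtain ⟨z, hz, hmin⟩ := Finset.exists_min_image w.support.toFinset ρ
      ⟨x, by simp⟩
    rw [List.mem_toFinset] at hz
    have hmin' : ∀ y ∈ w.support, ρ z ≤ ρ y := fun y hy => hmin y (List.mem_toFinset.2 hy)
    have hsum := congrArg Walk.length (w.take_spec hz)
    rw [Walk.length_append] at hsum
    have hx : (a z, ⟨(w.takeUntil z hz).length, by omega⟩) ∈ κ x :=
      ⟨z, rfl, w.takeUntil z hz, rfl,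
        fun v hv => hmin' v (w.support_takeUntil_subset_support hz hv)⟩
    rw [heq] at hx
    obtain ⟨z', haz, q, hq, hqs⟩ := hx
    simp only at haz hq
    have hds : ∀ v ∈ (w.dropUntil z hz).support, ρ z ≤ ρ v := fun v hv =>
      hmin' v (w.support_dropUntil_subset_support hz hv)
    -- `q` has the length of the part of `w` that it replaces, so `c` again has length `p`.
    let c := (w.dropUntil z hz).append q
    have hc : c.length = p := by
      rw [Walk.length_append]
      omega
    have hcs : ∀ v ∈ c.support, ρ z ≤ ρ v ∨ ρ z' ≤ ρ v := fun v hv =>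
      ((Walk.mem_support_append_iff _ _).1 hv).imp (hds v) (hqs v)
    -- All of `c` lies above the lower of its two ends, so that end is weakly `p`-reachable from the
    -- other; equal colours then force equality.
    have hzz : z = z' := by
      by_contra hne
      rcases lt_or_gt_of_ne fun h => hne (hinj h) with hlt | hlt
      · refine ha z' z (hF z' z ⟨c.reverse, by simp [hc], fun v hv => ?_⟩) hlt haz.symm
        rw [Walk.support_reverse, List.mem_reverse] at hv
        rcases hcs v hv with h | h
        exacts [h, hlt.le.trans h]
      · refine ha z z' (hF z z' ⟨c, hc.le, fun v hv => ?_⟩) hlt haz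
        rcases hcs v hv with h | h
        exacts [hlt.le.trans h, h]
    subst hzz
    have := oddGirth_le_of_odd_closed_walk c (hc ▸ hp)
    rw [hc] at this
    exact absurd hG (not_lt.2 this)
  refine Colorable.chromaticNumber_le ?_
  have hcol := (Coloring.mk κ hκ).colorable
  rwa [Fintype.card_set, Fintype.card_prod, Fintype.card_fin, Fintype.card_fin] at hcol

end SimpleGraph

theorem mainTheorem2 (K : Set FiniteGraph.{u}) (hK : BoundedExpansion K) (p : ℕ) (hp : Odd p) :
    ∃ N : ℕ, ∀ G ∈ K, (p : ℕ∞) < G.graph.oddGirth →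
      (G.graph.exactPower p).chromaticNumber ≤ (N : ℕ∞) := by
  obtain ⟨f, hf⟩ := hK
  let M := 4 * f (2 * p) + f p * (1 + 2 * (2 * p + 1) * f (2 * p) * (4 * f (2 * p) + 1))
  refine ⟨2 ^ (((M + 1) ^ p + 1) * (p + 1)), fun G hG hodd => ?_⟩
  obtain ⟨ρ, hinj, hρ⟩ := SimpleGraph.exists_rank
    (SimpleGraph.exists_separated_vertex (hf G hG (2 * p)) (hf G hG p))
  exact SimpleGraph.chromaticNumber_exactPower_le hp hodd hinj
    (SimpleGraph.exists_finset_weaklyReachable hinj hρ p le_rfl)
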